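/- Consider a $K$-user real Gaussian interference channel (GIFC) with gain matrix $H=(h_{i,j})\in\mathbb{R}^{K\times K}$, where $h_{i,j}$ is the gain from transmitter $i$ to receiver $j$: at time $t$ receiver $j$ observes $y_{j,t}=z_{j,t}+\sum_{i=1}^K x_{i,t}h_{i,j}$, where the $z_{j,t}$ are Gaussian with mean $0$ and variance $1$, independent across times and receivers. For $P>0$ let $\mathcal{C}(H,P)$ be the set of rate tuples $(R_1,\dots,R_K)\in[0,\infty)^K$ for which there is a sequence, indexed by the block length $n$, of coding schemes as follows. The message $W_i$ of transmitter $i$ is uniform on $\{1,\dots,2^{\lceil nR_i\rceil}\}$, and the messages are independent of each other and of the noise. Encoder $i$ maps each message to a codeword $x_i\in\mathbb{R}^n$ with $\sum_{t=1}^n x_{i,t}^2\le nP$. Decoder $i$ is a measurable map $g_i$ from $\mathbb{R}^n$ to the message set of user $i$. The error probabilities satisfy $\max_{1\le i\le K}\Pr\big(W_i\ne g_i(y_{i,1},\dots,y_{i,n})\big)\to 0$ as $n\to\infty$. The degrees of freedom of $H$ are $$DoF(H)=\limsup_{P\to\infty}\frac{\sup_{(R_1,\dots,R_K)\in\mathcal{C}(H,P)}\sum_{i=1}^K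 R_i}{\frac12\log_2 P}.$$ **Lemma.** Let $p,q$ be nonzero integers and $$\tilde H=\begin{bmatrix}1&0&0\\1&p&0\\1&q&1\end{bmatrix}.$$ Then $$DoF(\tilde H)\le\frac32-\epsilon(p,q),\qquad \epsilon(p,q)=\frac{1}{12\,d(p,q)+2}>0,\qquad d(p,q)=2\max\{|p|,|q|\}+5 .$$ -/

import Mathlib

open MeasureTheory ProbabilityTheory Filter Topology
open scoped NNReal ENNReal

namespace GIFC

/-- The message set of a user with rate `R` at block length `n`: it has `2 ^ ⌈n R⌉` elements. -/
abbrev Message (n : ℕ) (R : ℝ) : Type := Fin (2 ^ ⌈(n : ℝ) * R⌉₊)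

/-- A coding scheme of block length `n` with rate tuple `R` for `K` users:
encoders `f i` whose codewords lie in the ball of radius `√(n Pᵢ)` in `ℝⁿ`
(a power constraint on every codeword), and (Borel measurable) decoders `g i`. -/
structure CodingScheme {K : ℕ} (n : ℕ) (R P : Fin K → ℝ) where
  /-- the encoding functions -/
  f : (i : Fin K) → Message n (R i) → Fin n → ℝ
  /-- the decoding functions -/
  g : (i : Fin K) → (Fin n → ℝ) → Message n (R i)
  power_le : ∀ i w, ∑ t, f i w t ^ 2 ≤ n * P i
  measurable_g : ∀ i, Measurable (g i)

/-- The joint law of the messages, independent and uniform on their message sets. -/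
noncomputable def messageLaw {K : ℕ} (n : ℕ) (R : Fin K → ℝ) :
    Measure ((i : Fin K) → Message n (R i)) :=
  Measure.pi fun i => (PMF.uniformOfFintype (Message n (R i))).toMeasure

/-- The joint law of the noise: the noise at receiver `j` and time `t` is a centered Gaussian of
variance `v j`, independent across receivers and times. -/
noncomputable def noiseLaw {K : ℕ} (n : ℕ) (v : Fin K → ℝ≥0) :
    Measure (Fin K → Fin n → ℝ) :=
  Measure.pi fun j => Measure.pi fun _ => gaussianReal 0 (v j)

/-- The signal at receiver `j`, where `H i j` is the gain from transmitter `i` to receiver `j`,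
`x i` is the signal of transmitter `i` and `z j` is the noise at receiver `j`. -/
def received {K n : ℕ} (H : Matrix (Fin K) (Fin K) ℝ) (x z : Fin K → Fin n → ℝ) (j : Fin K) :
    Fin n → ℝ :=
  fun t => z j t + ∑ i, x i t * H i j

/-- The probability that receiver `i` decodes the message of transmitter `i` incorrectly.
The messages are independent of the noise. -/
noncomputable def errorProb {K n : ℕ} {R P : Fin K → ℝ} (H : Matrix (Fin K) (Fin K) ℝ)
    (v : Fin K → ℝ≥0) (c : CodingScheme n R P) (i : Fin K) : ℝ≥0∞ :=
  ((messageLaw n R).prod (noiseLaw n v))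
    {ω | c.g i (received H (fun k => c.f k (ω.1 k)) ω.2 i) ≠ ω.1 i}

/-- The capacity region of the `K`-user Gaussian interference channel with gain matrix `H`,
noise variances `v` and power constraints `P`. -/
def capacityRegion {K : ℕ} (H : Matrix (Fin K) (Fin K) ℝ) (v : Fin K → ℝ≥0) (P : Fin K → ℝ) :
    Set (Fin K → ℝ) :=
  {R | (∀ i, 0 ≤ R i) ∧ ∃ c : (n : ℕ) → CodingScheme n R P,
    Tendsto (fun n => ⨆ i, errorProb H v (c n) i) atTop (𝓝 0)}

/-- The degrees of freedom of `H`, with noise variances `1` and powers `P → ∞`. Supremum and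
limsup are taken in the extended reals, so that no boundedness is presupposed. -/
noncomputable def degreesOfFreedom {K : ℕ} (H : Matrix (Fin K) (Fin K) ℝ) : EReal :=
  limsup (fun P : ℝ =>
    (⨆ R ∈ capacityRegion H (fun _ => 1) (fun _ => P), ((∑ i, R i : ℝ) : EReal)) /
      (((1 / 2) * Real.logb 2 P : ℝ) : EReal)) atTop

/-- The exponent `d(p, q) = 2 max{|p|, |q|} + 5`. -/
def dilationExponent (p q : ℤ) : ℤ := 2 * max |p| |q| + 5

/-- The gap `ε(p, q) = 1 / (12 d(p, q) + 2)`. -/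
noncomputable def gap (p q : ℤ) : ℝ := 1 / (12 * (dilationExponent p q : ℝ) + 2)

end GIFC

/-!
In nats per channel use, let `N ≈ ½ log P` be the largest entropy of a received signal, and let
`X₁, X₂, X₃` be the codewords of the three users for independent uniform messages. The receivers
see `X₁ + X₂ + X₃`, `p X₂ + q X₃` and `X₃`, so that, up to bounded terms,

* `R₁ ≤ H(X₁ + X₂ + X₃) - H(X₂ + X₃) ≤ N - H(X₂ + X₃)`,
* `R₂ ≤ H(p X₂ + q X₃) - H(X₃)` and `R₃ ≤ H(X₃)`.

Any two of the rates have sum at most `N`. If the total were close to `3N/2`, each rate would be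
close to `N/2`; then `X₂ + X₃` would have entropy close to `N/2`, hardly more than `X₂` and `X₃`
have separately, while `p X₂ + q X₃` would need entropy close to `N`. This contradicts the
inequality for sums of dilates `entropy_zsmul_indepSum_zsmul_le`: if `X` and `Y` are independent
and `H(X + Y) ≤ min (H(X), H(Y)) + δ`, then `H(p X + q Y) ≤ H(X + Y) + (3 |p| + 3 |q| + 2) δ`. Its
proof is additive combinatorics with entropies in place of cardinalities: the triangle inequality
`entropy_ruzsa_triangle`, the Plünnecke inequality `entropy_indepSum_indepSum_le`, and the
splitting `entropy_add_zsmul_indepSum_le`, by which passing from `a X + Y` to `(a ± 1) X + Y`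
costs `3 δ`; all are instances of submodularity. The balance of these inequalities is computed in
`sum_le_of_entropy_inequalities`, and the gap is exact for the constant `3 d(p, q)`, which is at
least `3 |p| + 3 |q| + 2`.

The passage from the Gaussian channel to discrete entropies avoids differential entropy. Codewords
are rounded to integers, which keeps every signal an integer vector because the gains are
integers. All variables are then functions on a finite set of messages with uniform law, and every
entropy bound follows from Gibbs' inequality `entropy_prod_le` for a suitable kernel. For the
decoding bound `CodingScheme.entropy_roundedSignal_message_le` the kernel applies the given
decoder to Gaussian noise of variance `2` around the rounded signal: per coordinate, a bounded
multiple of this law dominates the law of the true received signal, so the loss is a constant per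
channel use, whatever the power. For the bound `CodingScheme.entropy_roundedSignal_le` by `N` the
kernel is a product of geometric laws.
-/

namespace GIFC

/-! ### Entropy on finite uniform probability spaces -/

section Entropy

variable {Ω Ω' α β γ ζ : Type*} [Fintype Ω] [Fintype Ω']

open Classical in
/-- The number of sample points at which `X` takes the same value as at `ω`. -/
noncomputable def fiberCard (X : Ω → α) (ω : Ω) : ℕ :=
  (Finset.univ.filter fun ω' => X ω' = X ω).card

/-- The Shannon entropy (in nats) of a function `X` of a uniformly distributed point of the finite
set `Ω`. The average of the information content is taken over sample points, rather than over
values, so that nothing is required of the target of `X`. -/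
noncomputable def entropy (X : Ω → α) : ℝ :=
  (∑ ω, Real.log (Fintype.card Ω / fiberCard X ω)) / Fintype.card Ω

lemma fiberCard_pos (X : Ω → α) (ω : Ω) : 0 < fiberCard X ω := by
  classical
  exact Finset.card_pos.2 ⟨ω, by simp⟩

lemma fiberCard_mono {X : Ω → α} {Y : Ω → β} (h : ∀ ω ω', X ω = X ω' → Y ω = Y ω') (ω : Ω) :
    fiberCard X ω ≤ fiberCard Y ω := by
  classical
  refine Finset.card_le_card fun ω' hω' => ?_
  simp only [Finset.mem_filter, Finset.mem_univ, true_and] at hω' ⊢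
  exact h _ _ hω'

/-- A function of a random variable has at most its entropy. -/
lemma entropy_mono {X : Ω → α} {Y : Ω → β} (h : ∀ ω ω', X ω = X ω' → Y ω = Y ω') :
    entropy Y ≤ entropy X := by
  unfold entropy
  gcongr with ω
  · have h1 := fiberCard_pos Y ω
    have : 0 < Fintype.card Ω := Fintype.card_pos_iff.2 ⟨ω⟩
    positivity
  · exact_mod_cast fiberCard_pos X ω
  · exact fiberCard_mono h ω

lemma entropy_congr {X : Ω → α} {Y : Ω → β} (h : ∀ ω ω', X ω = X ω' ↔ Y ω = Y ω') :
    entropy X = entropy Y :=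
  le_antisymm (entropy_mono fun ω ω' => (h ω ω').2) (entropy_mono fun ω ω' => (h ω ω').1)

lemma sum_div_card_fiber {Ω α : Type*} [DecidableEq α] (F : Finset Ω) (W : Ω → α) (g : α → ℝ) :
    ∑ ω ∈ F, g (W ω) / ((F.filter fun ω' => W ω' = W ω).card : ℝ) = ∑ w ∈ F.image W, g w := by
  rw [Finset.sum_comp (fun w => g w / ((F.filter fun ω' => W ω' = w).card : ℝ)) W]
  refine Finset.sum_congr rfl fun w hw => ?_
  obtain ⟨ω, hω, rfl⟩ := Finset.mem_image.1 hw
  have : (0 : ℝ) < ((F.filter fun ω' => W ω' = W ω).card : ℝ) := by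
    exact_mod_cast Finset.card_pos.2 ⟨ω, by simp [hω]⟩
  rw [nsmul_eq_mul]
  field_simp

/-- Gibbs' inequality in conditional form: the conditional entropy of `W` given `U` is at most the
mean of `-log q(W | U)`, for every sub-probability kernel `q`. -/
lemma entropy_prod_le (U : Ω → β) (W : Ω → α) (q : β → α → ℝ) (hq : ∀ ω, 0 < q (U ω) (W ω))
    (hsum : ∀ ω (s : Finset α), ∑ w ∈ s, q (U ω) w ≤ 1) :
    entropy (fun ω => (U ω, W ω)) ≤
      entropy U + (∑ ω, -Real.log (q (U ω) (W ω))) / Fintype.card Ω := by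
  classical
  unfold entropy
  rw [← add_div]
  gcongr
  rw [← Finset.sum_add_distrib, ← sub_nonpos, ← Finset.sum_sub_distrib]
  have key : ∑ ω, (fiberCard U ω * q (U ω) (W ω) / fiberCard (fun ω => (U ω, W ω)) ω : ℝ)
      ≤ ∑ _ω : Ω, 1 := by
    have e : ∀ ω, (fiberCard U ω * q (U ω) (W ω) / fiberCard (fun ω => (U ω, W ω)) ω : ℝ) =
        ∑ ω', if U ω' = U ω then
          q (U ω') (W ω) / fiberCard (fun ω => (U ω, W ω)) ω else 0 := by
      intro ω
      rw [← Finset.sum_filter, Finset.sum_congr rfl (g := fun _ =>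
        q (U ω) (W ω) / fiberCard (fun ω => (U ω, W ω)) ω)]
      · rw [Finset.sum_const, nsmul_eq_mul, fiberCard, mul_div_assoc]
      · intro ω' hω'
        rw [(Finset.mem_filter.1 hω').2]
    rw [Finset.sum_congr rfl fun ω _ => e ω, Finset.sum_comm]
    refine Finset.sum_le_sum fun ω' _ => ?_
    have hF := sum_div_card_fiber (Finset.univ.filter fun ω => U ω' = U ω) W (q (U ω'))
    rw [← Finset.sum_filter]
    refine le_trans (le_of_eq ?_) (hF.trans_le (hsum ω' _))
    refine Finset.sum_congr rfl fun ω hω => ?_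
    have hω := (Finset.mem_filter.1 hω).2
    congr 2
    unfold fiberCard
    congr 1
    ext ω''
    simp only [Finset.mem_filter, Finset.mem_univ, true_and, Prod.mk.injEq, hω]
    tauto
  rw [← sub_nonpos, ← Finset.sum_sub_distrib] at key
  refine le_trans (Finset.sum_le_sum fun ω _ => ?_) key
  have h1 : (0 : ℝ) < fiberCard U ω := by exact_mod_cast fiberCard_pos U ω
  have h2 : (0 : ℝ) < fiberCard (fun ω => (U ω, W ω)) ω := by
    exact_mod_cast fiberCard_pos (fun ω => (U ω, W ω)) ω
  have h3 : (0 : ℝ) < Fintype.card Ω := by exact_mod_cast Fintype.card_pos_iff.2 ⟨ω⟩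
  have h4 := hq ω
  refine le_trans (le_of_eq ?_) (Real.log_le_sub_one_of_pos (by positivity))
  rw [Real.log_div h3.ne' h2.ne', Real.log_div h3.ne' h1.ne', Real.log_div (by positivity) h2.ne',
    Real.log_mul h1.ne' h4.ne']
  ring

/-- Submodularity of entropy, for variables `P` and `Q` with a common function `V`, which together
determine `S`. -/
lemma entropy_submodular {P : Ω → α} {Q : Ω → β} {V : Ω → γ} {S : Ω → ζ}
    (hP : ∀ ω ω', P ω = P ω' → V ω = V ω') (hQ : ∀ ω ω', Q ω = Q ω' → V ω = V ω')
    (hS : ∀ ω ω', P ω = P ω' → Q ω = Q ω' → S ω = S ω') :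
    entropy S + entropy V ≤ entropy P + entropy Q := by
  classical
  rcases isEmpty_or_nonempty Ω with hΩ | hΩ
  · simp [entropy]
  have hS' : entropy S ≤ entropy (fun ω => (Q ω, P ω)) :=
    entropy_mono fun ω ω' h => by simp only [Prod.mk.injEq] at h; exact hS _ _ h.2 h.1
  -- the kernel is the conditional law of `P` given `V`, read as a function of `Q`
  let N : α → ℝ := fun a => (Finset.univ.filter fun ω => P ω = a).card
  let q : β → α → ℝ := fun b a =>
    if ∃ ω ω', P ω = a ∧ Q ω' = b ∧ V ω = V ω' then
      N a / (Finset.univ.filter fun ω => ∃ ω', Q ω' = b ∧ V ω = V ω').card else 0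
  have hden : ∀ ω, (Finset.univ.filter fun ω₁ => ∃ ω', Q ω' = Q ω ∧ V ω₁ = V ω').card =
      fiberCard V ω := by
    intro ω
    unfold fiberCard
    congr 1
    ext ω₁
    simp only [Finset.mem_filter, Finset.mem_univ, true_and]
    constructor
    · rintro ⟨ω', h1, h2⟩
      rw [h2, hQ _ _ h1]
    · intro h
      exact ⟨ω, rfl, h⟩
  have hqv : ∀ ω, q (Q ω) (P ω) = fiberCard P ω / fiberCard V ω := by
    intro ω
    simp only [q, N]
    rw [if_pos ⟨ω, ω, rfl, rfl, rfl⟩, hden ω]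
    rfl
  have h := entropy_prod_le Q P q ?_ ?_
  · refine (add_le_add_left (hS'.trans h) _).trans (le_of_eq ?_)
    simp only [hqv]
    have : (∑ ω, -Real.log ((fiberCard P ω : ℝ) / fiberCard V ω)) / Fintype.card Ω =
        entropy P - entropy V := by
      unfold entropy
      rw [← sub_div, ← Finset.sum_sub_distrib]
      congr 1
      refine Finset.sum_congr rfl fun ω _ => ?_
      have h1 : (0 : ℝ) < fiberCard P ω := by exact_mod_cast fiberCard_pos P ω
      have h2 : (0 : ℝ) < fiberCard V ω := by exact_mod_cast fiberCard_pos V ω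
      have h3 : (0 : ℝ) < Fintype.card Ω := by exact_mod_cast Fintype.card_pos_iff.2 ⟨ω⟩
      rw [Real.log_div h3.ne' h2.ne', Real.log_div h3.ne' h1.ne', Real.log_div h1.ne' h2.ne']
      ring
    rw [this]
    ring
  · intro ω
    rw [hqv]
    have h1 := fiberCard_pos P ω
    have h2 := fiberCard_pos V ω
    positivity
  · intro ω s
    simp only [q, hden ω]
    have h2 : (0 : ℝ) < fiberCard V ω := by exact_mod_cast fiberCard_pos V ω
    rw [← Finset.sum_filter, ← Finset.sum_div, div_le_one h2]
    simp only [N]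
    rw [← Nat.cast_sum]
    norm_cast
    rw [← Finset.card_biUnion]
    · refine Finset.card_le_card fun ω₁ h => ?_
      simp only [Finset.mem_biUnion, Finset.mem_filter, Finset.mem_univ, true_and] at h ⊢
      obtain ⟨a, ⟨-, ω₂, ω', h3, h4, h5⟩, h6⟩ := h
      rw [hP ω₁ ω₂ (h6.trans h3.symm), h5, hQ _ _ h4]
    · intro a _ b _ hab
      refine Finset.disjoint_left.2 fun ω₁ h3 h4 => hab ?_
      rw [← (Finset.mem_filter.1 h3).2, (Finset.mem_filter.1 h4).2]

lemma entropy_comp_equiv (e : Ω' ≃ Ω) (X : Ω → α) : entropy (fun ω => X (e ω)) = entropy X := by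
  classical
  unfold entropy
  rw [Fintype.card_congr e, ← e.sum_comp]
  congr 1
  refine Finset.sum_congr rfl fun ω _ => ?_
  congr 3
  unfold fiberCard
  exact Finset.card_equiv e (by simp)

/-- The entropy of a pair of independent variables. -/
lemma entropy_pair [Nonempty Ω] [Nonempty Ω'] (X : Ω → α) (Y : Ω' → β) :
    entropy (fun ω : Ω × Ω' => (X ω.1, Y ω.2)) = entropy X + entropy Y := by
  classical
  have hN : ∀ ω : Ω × Ω', fiberCard (fun ω : Ω × Ω' => (X ω.1, Y ω.2)) ω =
      fiberCard X ω.1 * fiberCard Y ω.2 := by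
    intro ω
    unfold fiberCard
    rw [← Finset.card_product]
    congr 1
    ext ω'
    simp
  have h3 : (0 : ℝ) < Fintype.card Ω := by exact_mod_cast Fintype.card_pos
  have h4 : (0 : ℝ) < Fintype.card Ω' := by exact_mod_cast Fintype.card_pos
  unfold entropy
  simp only [hN]
  have : ∀ ω : Ω × Ω', Real.log (Fintype.card (Ω × Ω') / (fiberCard X ω.1 * fiberCard Y ω.2 : ℕ))
      = Real.log (Fintype.card Ω / fiberCard X ω.1) +
        Real.log (Fintype.card Ω' / fiberCard Y ω.2) := by
    intro ω
    have h1 : (0 : ℝ) < fiberCard X ω.1 := by exact_mod_cast fiberCard_pos X ω.1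
    have h2 : (0 : ℝ) < fiberCard Y ω.2 := by exact_mod_cast fiberCard_pos Y ω.2
    rw [← Real.log_mul (by positivity) (by positivity), Fintype.card_prod, div_mul_div_comm]
    push_cast
    rfl
  simp only [this]
  rw [Fintype.sum_prod_type]
  simp only [Finset.sum_add_distrib, Finset.sum_const, Finset.card_univ, nsmul_eq_mul,
    Fintype.card_prod, Nat.cast_mul, ← Finset.mul_sum]
  field_simp

lemma entropy_const (c : α) : entropy (fun _ : Ω => c) = 0 := by
  rcases isEmpty_or_nonempty Ω with hΩ | hΩ
  · simp [entropy]
  · have h3 : (Fintype.card Ω : ℝ) ≠ 0 := by exact_mod_cast Fintype.card_ne_zero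
    simp [entropy, fiberCard, h3]

lemma entropy_comp_fst [Nonempty Ω] [Nonempty Ω'] (X : Ω → α) :
    entropy (fun ω : Ω × Ω' => X ω.1) = entropy X := by
  have h := entropy_pair X (fun _ : Ω' => ())
  rw [entropy_const, add_zero] at h
  rw [← h]
  exact entropy_congr fun ω ω' => by simp

lemma entropy_comp_snd [Nonempty Ω] [Nonempty Ω'] (X : Ω' → α) :
    entropy (fun ω : Ω × Ω' => X ω.2) = entropy X := by
  have h := entropy_pair (fun _ : Ω => ()) X
  rw [entropy_const, zero_add] at h
  rw [← h]
  exact entropy_congr fun ω ω' => by simp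

lemma entropy_of_injective [Nonempty Ω] {X : Ω → α} (hX : Function.Injective X) :
    entropy X = Real.log (Fintype.card Ω) := by
  have h3 : (Fintype.card Ω : ℝ) ≠ 0 := by exact_mod_cast Fintype.card_ne_zero
  have h : ∀ ω, fiberCard X ω = 1 := by
    intro ω
    classical
    exact Finset.card_eq_one.2 ⟨ω, by ext ω'; simp [hX.eq_iff]⟩
  simp [entropy, h, h3]

/-- Entropy is subadditive. -/
lemma entropy_prod_le_add (P : Ω → α) (Q : Ω → β) :
    entropy (fun ω => (P ω, Q ω)) ≤ entropy P + entropy Q := by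
  have h := entropy_submodular (P := P) (Q := Q) (V := fun _ => ()) (S := fun ω => (P ω, Q ω))
    (fun _ _ _ => rfl) (fun _ _ _ => rfl) (fun ω ω' h1 h2 => by rw [h1, h2])
  rwa [entropy_const, add_zero] at h

/-- Gibbs' inequality. -/
lemma entropy_le_sum_neg_log (W : Ω → α) (q : α → ℝ) (hq : ∀ ω, 0 < q (W ω))
    (hsum : ∀ s : Finset α, ∑ w ∈ s, q w ≤ 1) :
    entropy W ≤ (∑ ω, -Real.log (q (W ω))) / Fintype.card Ω := by
  have h := entropy_prod_le (fun _ => ()) W (fun _ => q) hq (fun _ => hsum)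
  rw [entropy_const, zero_add] at h
  exact (entropy_mono fun ω ω' h => (Prod.mk.inj h).2).trans h

end Entropy

/-! ### Sums of independent variables and their dilates -/

section Sums

variable {Ω₁ Ω₂ Ω₃ G : Type*} [Fintype Ω₁] [Fintype Ω₂] [Fintype Ω₃]
  [AddCommGroup G]

/-- The sum of independent copies of `X` and `Y`, a variable on the product of their sample
spaces. -/
def indepSum {Ω₁ Ω₂ G : Type*} [Add G] (X : Ω₁ → G) (Y : Ω₂ → G) (ω : Ω₁ × Ω₂) : G :=
  X ω.1 + Y ω.2

local infixl:65 " ⊹ " => indepSum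

lemma entropy_indepSum_comm (X : Ω₁ → G) (Y : Ω₂ → G) : entropy (X ⊹ Y) = entropy (Y ⊹ X) := by
  rw [← entropy_comp_equiv (Equiv.prodComm Ω₁ Ω₂) (Y ⊹ X)]
  congr 1
  ext ω
  exact add_comm _ _

lemma entropy_indepSum_right_comm (X : Ω₁ → G) (Y : Ω₂ → G) (Z : Ω₃ → G) :
    entropy (X ⊹ Y ⊹ Z) = entropy (X ⊹ Z ⊹ Y) := by
  let e : (Ω₁ × Ω₂) × Ω₃ ≃ (Ω₁ × Ω₃) × Ω₂ :=
    { toFun := fun ω => ((ω.1.1, ω.2), ω.1.2)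
      invFun := fun ω => ((ω.1.1, ω.2), ω.1.2)
      left_inv := fun _ => rfl
      right_inv := fun _ => rfl }
  rw [← entropy_comp_equiv e (X ⊹ Z ⊹ Y)]
  congr 1
  ext ω
  exact add_right_comm _ _ _

lemma entropy_neg (X : Ω₁ → G) : entropy (-X) = entropy X :=
  entropy_congr fun ω ω' => by simp

lemma entropy_neg_indepSum_neg (X : Ω₁ → G) (Y : Ω₂ → G) :
    entropy ((-X) ⊹ (-Y)) = entropy (X ⊹ Y) :=
  entropy_congr fun ω ω' => by
    simp only [indepSum, Pi.neg_apply, ← neg_add, neg_inj]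

variable [Nonempty Ω₁] [Nonempty Ω₂] [Nonempty Ω₃]

/-- A sum of independent variables has at least the entropy of each summand. -/
lemma entropy_le_indepSum_left (X : Ω₁ → G) (Y : Ω₂ → G) : entropy X ≤ entropy (X ⊹ Y) := by
  have h := entropy_submodular (Ω := Ω₁ × Ω₂) (P := X ⊹ Y) (Q := fun ω => Y ω.2) (V := fun _ => ())
    (S := fun ω => (X ω.1, Y ω.2)) (fun _ _ _ => rfl) (fun _ _ _ => rfl) (fun ω ω' h1 h2 => by
      simp only [indepSum] at h1
      rw [h2, add_left_inj] at h1
      rw [h1, h2])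
  rw [entropy_pair, entropy_const, entropy_comp_snd] at h
  linarith

lemma entropy_le_indepSum_right (X : Ω₁ → G) (Y : Ω₂ → G) : entropy Y ≤ entropy (X ⊹ Y) := by
  rw [entropy_indepSum_comm]
  exact entropy_le_indepSum_left Y X

lemma entropy_indepSum_le_add (X : Ω₁ → G) (Y : Ω₂ → G) :
    entropy (X ⊹ Y) ≤ entropy X + entropy Y := by
  rw [← entropy_pair]
  refine entropy_mono fun ω ω' h => ?_
  simp only [Prod.mk.injEq] at h
  simp only [indepSum, h]

/-- Submodularity on a product of three sample spaces, for a variable `V` which is a function both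
of `X` and `Z` and of another variable `Q`, where `X`, `Z` and `Q` determine the middle variable
`Y`. -/
lemma entropy_submodular_triple {α β : Type*} {X Y Z : Type*} {x : Ω₁ → X} {y : Ω₂ → Y}
    {z : Ω₃ → Z} (Q : (Ω₁ × Ω₃) × Ω₂ → β) (V : Ω₁ × Ω₃ → α)
    (hV : ∀ ω ω', x ω.1 = x ω'.1 → z ω.2 = z ω'.2 → V ω = V ω')
    (hQ : ∀ ω ω', Q ω = Q ω' → V ω.1 = V ω'.1)
    (hS : ∀ ω ω', Q ω = Q ω' → x ω.1.1 = x ω'.1.1 → z ω.1.2 = z ω'.1.2 → y ω.2 = y ω'.2) :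
    entropy V + entropy y ≤ entropy Q := by
  have h := entropy_submodular (P := fun ω : (Ω₁ × Ω₃) × Ω₂ => (x ω.1.1, z ω.1.2)) (Q := Q)
    (V := fun ω => V ω.1) (S := fun ω => ((x ω.1.1, z ω.1.2), y ω.2))
    (fun ω ω' h => hV _ _ (Prod.mk.inj h).1 (Prod.mk.inj h).2) hQ
    (fun ω ω' h1 h2 => by
      have h1' := Prod.mk.inj h1
      rw [hS _ _ h2 h1'.1 h1'.2, h1'.1, h1'.2])
  rw [entropy_pair (fun ω : Ω₁ × Ω₃ => (x ω.1, z ω.2)) y, entropy_pair, entropy_comp_fst V,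
    entropy_comp_fst (fun ω : Ω₁ × Ω₃ => (x ω.1, z ω.2)), entropy_pair] at h
  linarith

/-- The entropic Ruzsa triangle inequality, in additive form. -/
lemma entropy_ruzsa_triangle (X : Ω₁ → G) (Y : Ω₂ → G) (Z : Ω₃ → G) :
    entropy (X ⊹ Z) + entropy Y ≤ entropy (X ⊹ Y) + entropy ((-Y) ⊹ Z) := by
  let Q : (Ω₁ × Ω₃) × Ω₂ → G × G := fun ω => (X ω.1.1 + Y ω.2, -Y ω.2 + Z ω.1.2)
  have hQ : entropy Q ≤ entropy (X ⊹ Y) + entropy ((-Y) ⊹ Z) := by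
    refine (entropy_prod_le_add _ _).trans (le_of_eq ?_)
    congr 1
    · rw [← entropy_comp_fst (Ω' := Ω₃) (X ⊹ Y)]
      exact (entropy_comp_equiv (Equiv.mk (fun ω : (Ω₁ × Ω₃) × Ω₂ => ((ω.1.1, ω.2), ω.1.2))
        (fun ω => ((ω.1.1, ω.2), ω.1.2)) (fun _ => rfl) (fun _ => rfl))
        (fun ω : (Ω₁ × Ω₂) × Ω₃ => (X ⊹ Y) ω.1))
    · rw [← entropy_comp_snd (Ω := Ω₁) ((-Y) ⊹ Z)]
      exact (entropy_comp_equiv (Equiv.mk (fun ω : (Ω₁ × Ω₃) × Ω₂ => (ω.1.1, (ω.2, ω.1.2)))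
        (fun ω => ((ω.1, ω.2.2), ω.2.1)) (fun _ => rfl) (fun _ => rfl))
        (fun ω : Ω₁ × (Ω₂ × Ω₃) => ((-Y) ⊹ Z) ω.2))
  refine (entropy_submodular_triple (x := X) (y := Y) (z := Z) Q (X ⊹ Z) ?_ ?_ ?_).trans hQ
  · intro ω ω' h1 h2
    simp only [indepSum, h1, h2]
  · intro ω ω' h
    obtain ⟨h1, h2⟩ := Prod.mk.inj h
    have := congrArg₂ (· + ·) h1 h2
    simpa [indepSum, add_assoc] using this
  · intro ω ω' h h1 _
    have h3 := (Prod.mk.inj h).1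
    rwa [h1, add_right_inj] at h3

/-- The entropic Plünnecke inequality for three summands. -/
lemma entropy_indepSum_indepSum_le (X : Ω₁ → G) (Y : Ω₂ → G) (Z : Ω₃ → G) :
    entropy (X ⊹ Y ⊹ Z) + entropy Y ≤ entropy (X ⊹ Y) + entropy (Y ⊹ Z) := by
  have h := entropy_submodular (Ω := (Ω₁ × Ω₂) × Ω₃) (P := fun ω => (X ω.1.1 + Y ω.1.2, Z ω.2))
    (Q := fun ω => (X ω.1.1, Y ω.1.2 + Z ω.2)) (V := X ⊹ Y ⊹ Z)
    (S := fun ω => ((X ω.1.1, Y ω.1.2), Z ω.2)) ?_ ?_ ?_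
  · rw [entropy_pair (fun ω : Ω₁ × Ω₂ => (X ω.1, Y ω.2)) Z, entropy_pair,
      entropy_pair (fun ω : Ω₁ × Ω₂ => X ω.1 + Y ω.2) Z] at h
    have h2 : entropy (fun ω : (Ω₁ × Ω₂) × Ω₃ => (X ω.1.1, Y ω.1.2 + Z ω.2)) =
        entropy X + entropy (Y ⊹ Z) := by
      rw [← entropy_pair]
      exact entropy_comp_equiv (Equiv.prodAssoc Ω₁ Ω₂ Ω₃) (fun ω => (X ω.1, (Y ⊹ Z) ω.2))
    rw [h2] at h
    change _ ≤ entropy (X ⊹ Y) + _ + _ at h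
    linarith
  · intro ω ω' h
    obtain ⟨h1, h2⟩ := Prod.mk.inj h
    simp only [indepSum, h1, h2]
  · intro ω ω' h
    obtain ⟨h1, h2⟩ := Prod.mk.inj h
    simp only [indepSum, add_assoc, h1, h2]
  · intro ω ω' h1 h2
    obtain ⟨h1, h3⟩ := Prod.mk.inj h1
    obtain ⟨h2, h4⟩ := Prod.mk.inj h2
    rw [h2, add_right_inj] at h1
    rw [h1, h2, h3]

/-- Two dilates of `X` are split apart: `(a + b) X + Y = (a X + W) + (b X + Y - W)`, where `W` is
independent of `X` and `Y`. -/
lemma entropy_add_zsmul_indepSum_le (a b : ℤ) (X : Ω₁ → G) (Y : Ω₂ → G) (W : Ω₃ → G) :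
    entropy (((a + b) • X) ⊹ Y) + entropy W ≤
      entropy ((a • X) ⊹ W) + entropy ((b • X) ⊹ Y ⊹ (-W)) := by
  let Q : (Ω₁ × Ω₂) × Ω₃ → G × G :=
    fun ω => (a • X ω.1.1 + W ω.2, b • X ω.1.1 + Y ω.1.2 + -W ω.2)
  have hQ : entropy Q ≤ entropy ((a • X) ⊹ W) + entropy ((b • X) ⊹ Y ⊹ (-W)) := by
    refine (entropy_prod_le_add _ _).trans (le_of_eq ?_)
    congr 1
    rw [← entropy_comp_fst (Ω' := Ω₂) ((a • X) ⊹ W)]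
    exact (entropy_comp_equiv (Equiv.mk (fun ω : (Ω₁ × Ω₂) × Ω₃ => ((ω.1.1, ω.2), ω.1.2))
      (fun ω => ((ω.1.1, ω.2), ω.1.2)) (fun _ => rfl) (fun _ => rfl))
      (fun ω : (Ω₁ × Ω₃) × Ω₂ => ((a • X) ⊹ W) ω.1))
  refine (entropy_submodular_triple (x := X) (y := W) (z := Y) Q (((a + b) • X) ⊹ Y)
    ?_ ?_ ?_).trans hQ
  · intro ω ω' h1 h2
    simp only [indepSum, Pi.smul_apply, h1, h2]
  · intro ω ω' h
    obtain ⟨h1, h2⟩ := Prod.mk.inj h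
    have h3 := congrArg₂ (· + ·) h1 h2
    have e : ∀ x y w : G, (a • x + w) + (b • x + y + -w) = (a + b) • x + y := by
      intro x y w
      rw [add_smul]
      abel
    simp only [e] at h3
    exact h3
  · intro ω ω' h h1 _
    have h3 := (Prod.mk.inj h).1
    rwa [h1, add_right_inj] at h3

variable {X : Ω₁ → G} {Y : Ω₂ → G} {δ : ℝ}

/-- If `Y` has almost the entropy of `X + Y`, then `Y - Y'` has small entropy, where `Y'` is an
independent copy of `Y`. -/
lemma entropy_indepSum_neg_le (hX : entropy (X ⊹ Y) ≤ entropy X + δ) :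
    entropy (Y ⊹ (-Y)) ≤ entropy (X ⊹ Y) + δ := by
  have h := entropy_ruzsa_triangle Y X (-Y)
  rw [entropy_neg_indepSum_neg, entropy_indepSum_comm Y X] at h
  linarith

lemma entropy_indepSum_sub_le (hX : entropy (X ⊹ Y) ≤ entropy X + δ)
    (hY : entropy (X ⊹ Y) ≤ entropy Y + δ) :
    entropy (X ⊹ Y ⊹ (-Y)) ≤ entropy (X ⊹ Y) + 2 * δ := by
  have h1 := entropy_indepSum_indepSum_le X Y (-Y)
  have h2 := entropy_indepSum_neg_le hX
  linarith

lemma entropy_neg_indepSum_sub_le (hX : entropy (X ⊹ Y) ≤ entropy X + δ)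
    (hY : entropy (X ⊹ Y) ≤ entropy Y + δ) :
    entropy ((-X) ⊹ Y ⊹ (-Y)) ≤ entropy (X ⊹ Y) + 2 * δ := by
  have h1 := entropy_indepSum_indepSum_le (-X) (-Y) Y
  rw [entropy_neg_indepSum_neg, entropy_neg, entropy_indepSum_comm (-Y) Y,
    entropy_indepSum_right_comm] at h1
  have h2 := entropy_indepSum_neg_le hX
  linarith

lemma entropy_natCast_zsmul_indepSum_le (hY : entropy (X ⊹ Y) ≤ entropy Y + δ) {e : ℤ}
    (he : entropy ((e • X) ⊹ Y ⊹ (-Y)) ≤ entropy (X ⊹ Y) + 2 * δ) (m : ℕ) :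
    entropy (((m * e : ℤ) • X) ⊹ Y) ≤ entropy (X ⊹ Y) + 3 * m * δ := by
  induction m with
  | zero =>
    have h : entropy ((((0 : ℕ) * e : ℤ) • X) ⊹ Y) = entropy Y := by
      rw [← entropy_comp_snd (Ω := Ω₁) Y]
      congr 1
      ext ω
      simp [indepSum]
    rw [h]
    have := entropy_le_indepSum_right X Y
    simpa using this
  | succ m ih =>
    have h := entropy_add_zsmul_indepSum_le (m * e) e X Y Y
    have e1 : ((m + 1 : ℕ) * e : ℤ) = m * e + e := by push_cast; ring
    rw [e1]
    push_cast
    linarith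

/-- A dilate of `X` by an integer is added at a cost linear in the integer. -/
lemma entropy_zsmul_indepSum_le (hX : entropy (X ⊹ Y) ≤ entropy X + δ)
    (hY : entropy (X ⊹ Y) ≤ entropy Y + δ) (p : ℤ) :
    entropy ((p • X) ⊹ Y) ≤ entropy (X ⊹ Y) + 3 * |p| * δ := by
  have h1 := entropy_natCast_zsmul_indepSum_le hY (e := 1)
    (by simpa using entropy_indepSum_sub_le hX hY) p.natAbs
  have h2 := entropy_natCast_zsmul_indepSum_le hY (e := -1)
    (by simpa using entropy_neg_indepSum_sub_le hX hY) p.natAbs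
  rw [← Nat.cast_natAbs]
  rcases Int.natAbs_eq p with h | h
  · rw [mul_one, ← h] at h1
    simpa using h1
  · rw [mul_neg_one, ← h] at h2
    simpa using h2

/-- The entropic inequality for sums of dilates: if `X` and `Y` have almost the entropy of
`X + Y`, then so does `p X + q Y`. -/
theorem entropy_zsmul_indepSum_zsmul_le (hX : entropy (X ⊹ Y) ≤ entropy X + δ)
    (hY : entropy (X ⊹ Y) ≤ entropy Y + δ) (p q : ℤ) :
    entropy ((p • X) ⊹ (q • Y)) ≤ entropy (X ⊹ Y) + (3 * |p| + 3 * |q| + 2) * δ := by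
  have h1 := entropy_ruzsa_triangle (p • X) Y (q • Y)
  have h2 := entropy_ruzsa_triangle (-Y) (-X) (q • Y)
  rw [entropy_neg_indepSum_neg, neg_neg, entropy_neg, entropy_indepSum_comm Y X,
    entropy_indepSum_comm X (q • Y)] at h2
  have h3 := entropy_zsmul_indepSum_le hX hY p
  rw [entropy_indepSum_comm X Y] at hX hY
  have h4 := entropy_zsmul_indepSum_le hY hX q
  rw [entropy_indepSum_comm Y X] at hX hY h4
  linarith

end Sums

/-! ### Integer rounding and the Gaussian channel -/

section Gaussian

lemma measure_pi_mono {ι : Type*} [Fintype ι] {α : ι → Type*} [∀ i, MeasurableSpace (α i)]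
    {μ ν : ∀ i, Measure (α i)} [∀ i, SigmaFinite (μ i)] (h : ∀ i, μ i ≤ ν i) :
    Measure.pi μ ≤ Measure.pi ν := by
  refine Measure.le_iff.2 fun s hs => ?_
  have h1 : (Measure.pi μ).toOuterMeasure ≤
      OuterMeasure.pi fun i => (ν i).toOuterMeasure := by
    refine OuterMeasure.le_pi.2 fun t _ => ?_
    change Measure.pi μ _ ≤ _
    rw [Measure.pi_pi]
    exact Finset.prod_le_prod' fun i _ => h i _
  have h2 : Measure.pi ν s = OuterMeasure.pi (fun i => (ν i).toOuterMeasure) s := by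
    rw [Measure.pi_def, toMeasure_apply _ _ hs]
  rw [h2]
  exact h1 s

lemma measure_pi_const_smul {ι : Type*} [Fintype ι] {α : ι → Type*} [∀ i, MeasurableSpace (α i)]
    (ν : ∀ i, Measure (α i)) [∀ i, IsFiniteMeasure (ν i)] (c : ℝ≥0) :
    Measure.pi (fun i => c • ν i) = c ^ Fintype.card ι • Measure.pi ν := by
  refine Measure.pi_eq fun s _ => ?_
  simp only [Measure.smul_apply, Measure.pi_pi, ENNReal.smul_def, smul_eq_mul,
    Finset.prod_mul_distrib, Finset.prod_const, Finset.card_univ, ENNReal.coe_pow]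

/-- The factor by which a Gaussian law of variance `2` has to be multiplied to dominate a Gaussian
law of variance `1` whose mean is at distance at most `B`. -/
noncomputable def dominationFactor (B : ℝ) : ℝ≥0 := Real.toNNReal (2 * Real.exp (B ^ 2 / 2))

lemma coe_dominationFactor (B : ℝ) : (dominationFactor B : ℝ) = 2 * Real.exp (B ^ 2 / 2) :=
  Real.coe_toNNReal _ (by positivity)

lemma gaussianPDFReal_le {a u B : ℝ} (h : |a - u| ≤ B) (x : ℝ) :
    gaussianPDFReal a 1 x ≤ dominationFactor B * gaussianPDFReal u 2 x := by
  rw [coe_dominationFactor]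
  unfold gaussianPDFReal
  have e1 : Real.exp (-(x - a) ^ 2 / (2 * (1 : ℝ≥0))) ≤
      Real.exp (B ^ 2 / 2) * Real.exp (-(x - u) ^ 2 / (2 * (2 : ℝ≥0))) := by
    rw [← Real.exp_add, Real.exp_le_exp]
    have hB : (a - u) ^ 2 ≤ B ^ 2 := sq_le_sq' (by linarith [abs_le.1 h]) (abs_le.1 h).2
    push_cast
    nlinarith [sq_nonneg (x - a - (a - u))]
  have e2 : (√(2 * Real.pi * (1 : ℝ≥0)))⁻¹ ≤ 2 * (√(2 * Real.pi * (2 : ℝ≥0)))⁻¹ := by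
    have hpi := Real.pi_pos
    rw [← div_eq_mul_inv, inv_eq_one_div, div_le_div_iff₀ (by positivity) (by positivity), one_mul]
    rw [Real.sqrt_le_left (by positivity), mul_pow, Real.sq_sqrt (by positivity)]
    push_cast
    nlinarith
  calc _ ≤ (2 * (√(2 * Real.pi * (2 : ℝ≥0)))⁻¹) *
        (Real.exp (B ^ 2 / 2) * Real.exp (-(x - u) ^ 2 / (2 * (2 : ℝ≥0)))) := by gcongr
    _ = _ := by ring

lemma gaussianReal_le {a u B : ℝ} (h : |a - u| ≤ B) :
    gaussianReal a 1 ≤ dominationFactor B • gaussianReal u 2 := by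
  rw [gaussianReal_of_var_ne_zero _ one_ne_zero, gaussianReal_of_var_ne_zero _ two_ne_zero]
  have : dominationFactor B • volume.withDensity (gaussianPDF u 2) =
      volume.withDensity ((dominationFactor B : ℝ≥0∞) • gaussianPDF u 2) := by
    rw [withDensity_smul _ (measurable_gaussianPDF u 2)]
    rfl
  rw [this]
  refine withDensity_mono (ae_of_all _ fun x => ?_)
  simp only [gaussianPDF, Pi.smul_apply, smul_eq_mul]
  rw [ENNReal.coe_nnreal_eq, ← ENNReal.ofReal_mul (by positivity)]
  exact ENNReal.ofReal_le_ofReal (gaussianPDFReal_le h x)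

/-- A white noise vector with unit variance, shifted by `a`, is dominated by white noise with
variance `2`, centered at any nearby point `u`. -/
lemma pi_gaussianReal_shift_le {n : ℕ} {a u : Fin n → ℝ} {B : ℝ} (h : ∀ t, |a t - u t| ≤ B)
    {D : Set (Fin n → ℝ)} (hD : MeasurableSet D) :
    (Measure.pi fun _ : Fin n => gaussianReal 0 1).real {z | z + a ∈ D} ≤
      (2 * Real.exp (B ^ 2 / 2)) ^ n * (Measure.pi fun t => gaussianReal (u t) 2).real D := by
  have hmap : (Measure.pi fun _ : Fin n => gaussianReal 0 1).map (fun z => z + a) =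
      Measure.pi fun t => gaussianReal (a t) 1 := by
    have := Measure.pi_map_pi (μ := fun _ : Fin n => gaussianReal 0 1)
      (f := fun t x => x + a t) (hμ := fun t => by
        rw [gaussianReal_map_add_const]; infer_instance) (fun t => by fun_prop)
    simp only [gaussianReal_map_add_const, zero_add] at this
    exact this
  have hle := measure_pi_mono fun t => gaussianReal_le (h t)
  rw [measure_pi_const_smul, Fintype.card_fin, ← hmap] at hle
  have h2 := Measure.le_iff.1 hle D hD
  rw [Measure.map_apply (by fun_prop) hD] at h2
  have h3 := ENNReal.toReal_mono (measure_ne_top _ _) h2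
  have h4 : {z | z + a ∈ D} = (fun z => z + a) ⁻¹' D := rfl
  rw [← coe_dominationFactor, h4]
  simpa [Measure.real, ENNReal.smul_def] using h3

end Gaussian

section MaxEntropy

/-- The entropy of an integer vector with bounded mean absolute value, by comparison with a
two-sided geometric law. -/
lemma entropy_le_of_sum_abs_le {Ω : Type*} [Fintype Ω] [Nonempty Ω] {n : ℕ} (W : Ω → Fin n → ℤ)
    {T : ℝ} (hT : ∀ ω, ∑ t, |(W ω t : ℝ)| ≤ n * T) {M : ℕ} (hM : 0 < M) :
    entropy W ≤ n * (Real.log (2 * M + 1) + T / M) := by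
  classical
  have hM' : (0 : ℝ) < M := by exact_mod_cast hM
  set r : ℝ := M / (M + 1) with hr
  have hr0 : 0 < r := by positivity
  have hr1 : r < 1 := by rw [hr, div_lt_one (by positivity)]; linarith
  -- the ratio `r` is chosen so that the total mass of `r ^ |k|` over the integers is `2 M + 1`
  let f : ℤ → ℝ := fun k => r ^ k.natAbs / (2 * M + 1)
  have hf0 : ∀ k, 0 < f k := fun k => by positivity
  have hsum : HasSum f 1 := by
    have e : (1 - r)⁻¹ = M + 1 := by rw [hr]; field_simp; ring
    have h1 : HasSum (fun k : ℕ => f k) ((M + 1) / (2 * M + 1)) := by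
      have := (hasSum_geometric_of_lt_one hr0.le hr1).div_const (2 * M + 1 : ℝ)
      rw [e] at this
      simpa [f] using this
    have h2 : HasSum (fun k : ℕ => f (-(k + 1))) (M / (2 * M + 1)) := by
      have := ((hasSum_geometric_of_lt_one hr0.le hr1).mul_left r).div_const (2 * M + 1 : ℝ)
      rw [e, hr, div_mul_cancel₀ _ (by positivity), ← hr] at this
      refine this.congr_fun ?_
      intro k
      have : (-((k : ℤ) + 1)).natAbs = k + 1 := by omega
      simp only [f, this, pow_succ']
    have h3 := HasSum.of_nat_of_neg_add_one h1 h2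
    rwa [← add_div, show (M + 1 + M : ℝ) = 2 * M + 1 by ring, div_self (by positivity)] at h3
  have hq := entropy_le_sum_neg_log W (fun u => ∏ t, f (u t))
    (fun ω => Finset.prod_pos fun t _ => hf0 _) ?_
  · refine hq.trans ?_
    have hc : (0 : ℝ) < Fintype.card Ω := by exact_mod_cast Fintype.card_pos
    rw [div_le_iff₀ hc]
    have hb : ∀ ω ∈ Finset.univ, -Real.log (∏ t, f (W ω t)) ≤
        n * (Real.log (2 * M + 1) + T / M) := by
      intro ω _
      rw [Real.log_prod (fun t _ => (hf0 _).ne'), ← Finset.sum_neg_distrib]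
      have hlog : -Real.log r ≤ 1 / M := by
        rw [← Real.log_inv]
        refine (Real.log_le_sub_one_of_pos (by positivity)).trans (le_of_eq ?_)
        rw [hr]
        field_simp
        ring
      have hterm : ∀ t ∈ Finset.univ, -Real.log (f (W ω t)) ≤
          Real.log (2 * M + 1) + |(W ω t : ℝ)| / M := by
        intro t _
        rw [Real.log_div (by positivity) (by positivity), Real.log_pow]
        have : ((W ω t).natAbs : ℝ) = |(W ω t : ℝ)| := by
          rw [Nat.cast_natAbs]; push_cast; rfl
        rw [this]
        have h5 := mul_le_mul_of_nonneg_left hlog (abs_nonneg (W ω t : ℝ))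
        rw [mul_one_div] at h5
        linarith
      refine (Finset.sum_le_sum hterm).trans ?_
      rw [Finset.sum_add_distrib, ← Finset.sum_div, Finset.sum_const, Finset.card_univ,
        Fintype.card_fin, nsmul_eq_mul, mul_add, ← mul_div_assoc]
      gcongr
      exact hT ω
    refine (Finset.sum_le_sum hb).trans ?_
    rw [Finset.sum_const, Finset.card_univ, nsmul_eq_mul, mul_comm]
  · intro s
    let S : Fin n → Finset ℤ := fun t => s.image fun u => u t
    have hs : s ⊆ Fintype.piFinset S := fun u hu =>
      Fintype.mem_piFinset.2 fun t => Finset.mem_image_of_mem _ hu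
    refine (Finset.sum_le_sum_of_subset_of_nonneg hs fun u _ _ =>
      Finset.prod_nonneg fun t _ => (hf0 _).le).trans ?_
    rw [← Finset.prod_univ_sum]
    exact Finset.prod_le_one (fun t _ => Finset.sum_nonneg fun k _ => (hf0 k).le)
      fun t _ => sum_le_hasSum _ (fun k _ => (hf0 k).le) hsum

end MaxEntropy

section Channel

variable {K n : ℕ} {R P : Fin K → ℝ}

/-- The codewords of user `i`, rounded to integers coordinate by coordinate. -/
noncomputable def CodingScheme.roundedCodeword (c : CodingScheme n R P) (i : Fin K)
    (w : Message n (R i)) (t : Fin n) : ℤ := round (c.f i w t)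

/-- The signal at receiver `j` without the noise, if the transmitters send the rounded codewords
and the gains are the integers `A i j`. -/
noncomputable def CodingScheme.roundedSignal (c : CodingScheme n R P) (A : Matrix (Fin K) (Fin K) ℤ)
    (j : Fin K) (w : (i : Fin K) → Message n (R i)) (t : Fin n) : ℤ :=
  ∑ i, c.roundedCodeword i (w i) t * A i j

/-- The probability that receiver `i` decodes incorrectly, given the messages `w`. -/
noncomputable def CodingScheme.condError (c : CodingScheme n R P) (H : Matrix (Fin K) (Fin K) ℝ)
    (i : Fin K) (w : (i : Fin K) → Message n (R i)) : ℝ :=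
  (Measure.pi fun _ : Fin n => gaussianReal 0 1).real
    {z | c.g i (z + fun t => ∑ k, c.f k (w k) t * H k i) ≠ w i}

/-- The error probability is the mean of the conditional error probabilities. -/
lemma errorProb_toReal (c : CodingScheme n R P) (H : Matrix (Fin K) (Fin K) ℝ) (i : Fin K) :
    (errorProb H (fun _ => 1) c i).toReal =
      (∑ w, c.condError H i w) / Fintype.card ((i : Fin K) → Message n (R i)) := by
  have hmeas : MeasurableSet {ω : ((i : Fin K) → Message n (R i)) × (Fin K → Fin n → ℝ) |
      c.g i (received H (fun k => c.f k (ω.1 k)) ω.2 i) ≠ ω.1 i} := by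
    have h1 : Measurable fun ω : ((i : Fin K) → Message n (R i)) × (Fin K → Fin n → ℝ) =>
        (c.g i (received H (fun k => c.f k (ω.1 k)) ω.2 i), ω.1 i) := by
      refine Measurable.prodMk ((c.measurable_g i).comp ?_) (by fun_prop)
      refine measurable_pi_lambda _ fun t => ?_
      refine Measurable.add (by fun_prop) (Finset.measurable_sum _ fun k _ => ?_)
      refine Measurable.mul_const ?_ _
      exact (Measurable.of_discrete (f := fun m : Message n (R k) => c.f k m t)).comp
        (by fun_prop)
    exact h1 (MeasurableSet.of_discrete (s := {p | p.1 ≠ p.2}))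
  have hsing : ∀ w : (i : Fin K) → Message n (R i), messageLaw n R {w} =
      (Fintype.card ((i : Fin K) → Message n (R i)) : ℝ≥0∞)⁻¹ := by
    intro w
    unfold messageLaw
    rw [Measure.pi_singleton]
    simp only [PMF.toMeasure_apply_singleton _ _ (measurableSet_singleton _),
      PMF.uniformOfFintype_apply]
    rw [Fintype.card_pi, Nat.cast_prod, ENNReal.prod_inv_distrib]
    intro a _ b _ _
    simp
  have hnoise : ∀ w, noiseLaw n (fun _ => 1) (Prod.mk w ⁻¹'
      {ω : ((i : Fin K) → Message n (R i)) × (Fin K → Fin n → ℝ) |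
        c.g i (received H (fun k => c.f k (ω.1 k)) ω.2 i) ≠ ω.1 i}) =
      (Measure.pi fun _ : Fin n => gaussianReal 0 1)
        {z | c.g i (z + fun t => ∑ k, c.f k (w k) t * H k i) ≠ w i} := by
    intro w
    have := measurePreserving_eval (fun _ : Fin K => Measure.pi fun _ : Fin n => gaussianReal 0 1) i
    rw [← this.measure_preimage]
    · rfl
    · refine MeasurableSet.nullMeasurableSet ?_
      have h1 : Measurable fun z : Fin n → ℝ =>
        c.g i (z + fun t => ∑ k, c.f k (w k) t * H k i) := (c.measurable_g i).comp (by fun_prop)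
      exact h1 (MeasurableSet.of_discrete (s := {m | m ≠ w i}))
  have : SFinite (noiseLaw n (fun _ : Fin K => 1)) := by unfold noiseLaw; infer_instance
  unfold errorProb
  rw [Measure.prod_apply hmeas, lintegral_fintype]
  simp only [hsing, hnoise]
  rw [← Finset.sum_mul, ENNReal.toReal_mul, ENNReal.toReal_sum (fun w _ => measure_ne_top _ _),
    ENNReal.toReal_inv, div_eq_mul_inv]
  rfl

/-- Fano's inequality for the rounded channel: the noiseless rounded signal at a receiver determines
the message of its user up to an uncertainty which does not depend on the power. The kernel used in
Gibbs' inequality feeds the decoder with Gaussian noise of variance `2` around the rounded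
signal. -/
lemma CodingScheme.entropy_roundedSignal_message_le (c : CodingScheme n R P)
    (A : Matrix (Fin K) (Fin K) ℤ) (j : Fin K) {B : ℝ} (hB : ∑ i, |(A i j : ℝ)| ≤ B) :
    entropy (fun w => (c.roundedSignal A j w, w j)) ≤ entropy (c.roundedSignal A j) +
      (Real.log 4 + n * Real.log (2 * Real.exp (B ^ 2 / 2)) +
        2 * (errorProb (A.map Int.cast) (fun _ => 1) c j).toReal *
          Real.log (Fintype.card (Message n (R j)))) := by
  set m : ℝ := ((Fintype.card (Message n (R j)) : ℕ) : ℝ) with hm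
  set C : ℝ := 2 * Real.exp (B ^ 2 / 2) with hC
  have hm1 : 1 ≤ m := by
    rw [hm]
    exact_mod_cast Nat.one_le_iff_ne_zero.2 Fintype.card_ne_zero
  have hC1 : 1 ≤ C := by
    have := Real.one_le_exp (show 0 ≤ B ^ 2 / 2 by positivity)
    rw [hC]; linarith
  let ν : (Fin n → ℤ) → Measure (Fin n → ℝ) := fun u => Measure.pi fun t => gaussianReal (u t) 2
  have hνp : ∀ u, IsProbabilityMeasure (ν u) := fun u => by
    simp only [ν]; infer_instance
  let q : (Fin n → ℤ) → Message n (R j) → ℝ := fun u w =>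
    1 / 2 * (ν u).real (c.g j ⁻¹' {w}) + 1 / 2 * (1 / m)
  have hDm : ∀ w, MeasurableSet (c.g j ⁻¹' {w}) := fun w =>
    c.measurable_g j (measurableSet_singleton w)
  have hq0 : ∀ u w, 1 / 2 * (1 / m) ≤ q u w := fun u w => by
    have : 0 ≤ (ν u).real (c.g j ⁻¹' {w}) := measureReal_nonneg
    simp only [q]; linarith
  have hqpos : ∀ u w, 0 < q u w := fun u w => lt_of_lt_of_le (by positivity) (hq0 u w)
  have hG := entropy_prod_le (c.roundedSignal A j) (fun w => w j) q (fun ω => hqpos _ _) ?_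
  · refine hG.trans ?_
    gcongr
    rw [errorProb_toReal]
    have hcard : (0 : ℝ) < Fintype.card ((i : Fin K) → Message n (R i)) := by
      exact_mod_cast Fintype.card_pos
    rw [div_le_iff₀ hcard]
    have hb : ∀ w ∈ Finset.univ, -Real.log (q (c.roundedSignal A j w) (w j)) ≤
        Real.log 4 + n * Real.log C + 2 * c.condError (A.map Int.cast) j w * Real.log m := by
      intro w _
      set e := c.condError (A.map Int.cast) j w with he
      have he0 : 0 ≤ e := measureReal_nonneg
      have hlm : 0 ≤ Real.log m := Real.log_nonneg hm1
      have hlC : 0 ≤ n * Real.log C := mul_nonneg (by positivity) (Real.log_nonneg hC1)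
      -- if the decoder is right with probability at least `1 / 2`, the first term of the kernel is
      -- used; otherwise the uniform term suffices, because then `2 * e ≥ 1`
      rcases le_or_gt e (1 / 2) with h | h
      · have hcl : ∀ t, |(∑ k, c.f k (w k) t * (A.map Int.cast : Matrix _ _ ℝ) k j) -
            (c.roundedSignal A j w t : ℝ)| ≤ B := by
          intro t
          simp only [CodingScheme.roundedSignal, CodingScheme.roundedCodeword, Matrix.map_apply]
          push_cast
          rw [← Finset.sum_sub_distrib]
          refine (Finset.abs_sum_le_sum_abs _ _).trans (le_trans ?_ hB)
          refine Finset.sum_le_sum fun k _ => ?_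
          rw [← sub_mul, abs_mul]
          have := abs_sub_round (c.f k (w k) t)
          nlinarith [abs_nonneg (A k j : ℝ)]
        have hsh := pi_gaussianReal_shift_le hcl (hDm (w j))
        have hcompl : e = 1 - (Measure.pi fun _ : Fin n => gaussianReal 0 1).real
            {z | z + (fun t => ∑ k, c.f k (w k) t * (A.map Int.cast : Matrix _ _ ℝ) k j) ∈
              c.g j ⁻¹' {w j}} := by
          rw [← probReal_compl_eq_one_sub]
          · rfl
          · exact (measurable_id.add_const _) (hDm (w j))
        have hqge : 1 / (4 * C ^ n) ≤ q (c.roundedSignal A j w) (w j) := by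
          have h1 : 1 / 2 ≤ C ^ n * (ν (c.roundedSignal A j w)).real (c.g j ⁻¹' {w j}) := by
            refine le_trans ?_ hsh
            linarith
          have h2 : 0 < C ^ n := by positivity
          have h3 : 1 / (4 * C ^ n) ≤
              1 / 2 * (ν (c.roundedSignal A j w)).real (c.g j ⁻¹' {w j}) := by
            rw [div_le_iff₀ (by positivity)]
            linarith
          have h4 : 0 ≤ 1 / 2 * (1 / m) := by positivity
          simp only [q]
          linarith
        have h5 := Real.log_le_log (by positivity) hqge
        rw [one_div, Real.log_inv, Real.log_mul (by norm_num) (by positivity), Real.log_pow] at h5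
        have : 0 ≤ 2 * e * Real.log m := by positivity
        linarith
      · have h5 := Real.log_le_log (by positivity) (hq0 (c.roundedSignal A j w) (w j))
        rw [← mul_div_assoc, mul_one, div_div, one_div, Real.log_inv,
          Real.log_mul (by norm_num) (by positivity)] at h5
        have h6 : Real.log 2 ≤ Real.log 4 := Real.log_le_log (by norm_num) (by norm_num)
        have h7 : 1 * Real.log m ≤ 2 * e * Real.log m := by gcongr; linarith
        linarith
    refine (Finset.sum_le_sum hb).trans (le_of_eq ?_)
    rw [Finset.sum_add_distrib, Finset.sum_const, Finset.card_univ, nsmul_eq_mul, ← Finset.sum_mul,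
      ← Finset.mul_sum]
    field_simp
  · intro w s
    simp only [q]
    rw [Finset.sum_add_distrib, ← Finset.mul_sum, Finset.sum_const, nsmul_eq_mul,
      ← measureReal_biUnion_finset]
    · have h1 : (ν (c.roundedSignal A j w)).real (⋃ b ∈ s, c.g j ⁻¹' {b}) ≤ 1 := by
        have := hνp (c.roundedSignal A j w)
        exact measureReal_le_one
      have h2 : (s.card : ℝ) ≤ m := by
        rw [hm]
        exact_mod_cast Finset.card_le_univ s
      have h3 : (s.card : ℝ) * (1 / m) ≤ 1 := by
        rw [mul_one_div, div_le_one (by linarith)]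
        exact h2
      linarith
    · intro a _ b _ hab
      exact Disjoint.preimage _ (by simpa using hab)
    · exact fun b _ => hDm b

/-- The entropy of the rounded signal at a receiver, under a power constraint. -/
lemma CodingScheme.entropy_roundedSignal_le {Q : ℝ} (hQ : 1 ≤ Q)
    (c : CodingScheme n R fun _ => Q) (A : Matrix (Fin K) (Fin K) ℤ) (j : Fin K) {B : ℝ}
    (hB : ∑ i, |(A i j : ℝ)| ≤ B) :
    entropy (c.roundedSignal A j) ≤ n * (1 / 2 * Real.log Q + (Real.log 5 + 2 * B)) := by
  have hs1 : 1 ≤ √Q := Real.one_le_sqrt.2 hQ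
  have hsq : √Q ^ 2 = Q := Real.sq_sqrt (by linarith)
  have hB0 : 0 ≤ B := le_trans (Finset.sum_nonneg fun i _ => abs_nonneg _) hB
  have hM1 : √Q ≤ ⌈√Q⌉₊ := Nat.le_ceil _
  have hM2 : (⌈√Q⌉₊ : ℝ) < √Q + 1 := Nat.ceil_lt_add_one (by linarith)
  have hcode : ∀ i w, ∑ t, |(c.roundedCodeword i w t : ℝ)| ≤ n * (2 * √Q) := by
    intro i w
    have h1 : ∀ t ∈ Finset.univ, |(c.roundedCodeword i w t : ℝ)| ≤
        c.f i w t ^ 2 / (2 * √Q) + √Q := by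
      intro t _
      have h2 : |(c.roundedCodeword i w t : ℝ)| ≤ |c.f i w t| + 1 / 2 := by
        have h3 := abs_sub_round (c.f i w t)
        have h4 := abs_sub_abs_le_abs_sub ((round (c.f i w t) : ℤ) : ℝ) (c.f i w t)
        rw [abs_sub_comm] at h4
        simp only [CodingScheme.roundedCodeword]
        linarith
      have h5 : |c.f i w t| ≤ c.f i w t ^ 2 / (2 * √Q) + √Q / 2 := by
        rw [div_add_div _ _ (by positivity) (by norm_num), le_div_iff₀ (by positivity)]
        nlinarith [sq_nonneg (|c.f i w t| - √Q), sq_abs (c.f i w t)]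
      linarith
    refine (Finset.sum_le_sum h1).trans ?_
    rw [Finset.sum_add_distrib, ← Finset.sum_div, Finset.sum_const, Finset.card_univ,
      Fintype.card_fin, nsmul_eq_mul]
    have h6 : (∑ t, c.f i w t ^ 2) / (2 * √Q) ≤ n * √Q := by
      rw [div_le_iff₀ (by positivity)]
      have h7 : (0 : ℝ) ≤ n * Q := by positivity
      nlinarith [c.power_le i w]
    linarith
  have hsig : ∀ w, ∑ t, |(c.roundedSignal A j w t : ℝ)| ≤ n * (B * (2 * √Q)) := by
    intro w
    calc ∑ t, |(c.roundedSignal A j w t : ℝ)|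
        ≤ ∑ t, ∑ i, |(c.roundedCodeword i (w i) t : ℝ)| * |(A i j : ℝ)| := by
          refine Finset.sum_le_sum fun t _ => ?_
          simp only [CodingScheme.roundedSignal]
          push_cast
          refine (Finset.abs_sum_le_sum_abs _ _).trans (le_of_eq ?_)
          simp only [abs_mul]
      _ = ∑ i, (∑ t, |(c.roundedCodeword i (w i) t : ℝ)|) * |(A i j : ℝ)| := by
          rw [Finset.sum_comm]
          simp only [Finset.sum_mul]
      _ ≤ ∑ i, (n * (2 * √Q)) * |(A i j : ℝ)| := by
          gcongr with i
          exact hcode i (w i)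
      _ = (n * (2 * √Q)) * ∑ i, |(A i j : ℝ)| := by rw [Finset.mul_sum]
      _ ≤ (n * (2 * √Q)) * B := by gcongr
      _ = n * (B * (2 * √Q)) := by ring
  refine (entropy_le_of_sum_abs_le _ hsig (M := ⌈√Q⌉₊) (Nat.ceil_pos.2 (by linarith))).trans ?_
  refine mul_le_mul_of_nonneg_left ?_ (by positivity)
  have h1 : Real.log (2 * ⌈√Q⌉₊ + 1) ≤ Real.log (5 * √Q) :=
    Real.log_le_log (by positivity) (by linarith)
  rw [Real.log_mul (by norm_num) (by positivity), Real.log_sqrt (by linarith)] at h1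
  have h2 : B * (2 * √Q) / ⌈√Q⌉₊ ≤ 2 * B := by
    rw [div_le_iff₀ (by linarith)]
    nlinarith
  linarith

end Channel

/-! ### The three-user channel -/

section ThreeUsers

local infixl:65 " ⊹ " => indepSum

variable {n : ℕ} {R P : Fin 3 → ℝ}

/-- The gain matrix of the lemma, with integer entries. -/
def integerGains (p q : ℤ) : Matrix (Fin 3) (Fin 3) ℤ := !![1, 0, 0; 1, p, 0; 1, q, 1]

lemma integerGains_map (p q : ℤ) :
    (integerGains p q).map Int.cast =
      (!![1, 0, 0; 1, (p : ℝ), 0; 1, (q : ℝ), 1] : Matrix _ _ ℝ) := by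
  ext i j
  fin_cases i <;> fin_cases j <;> simp [integerGains]

lemma sum_abs_integerGains_le (p q : ℤ) (j : Fin 3) :
    ∑ i, |(integerGains p q i j : ℝ)| ≤ 3 + |(p : ℝ)| + |(q : ℝ)| := by
  have hp := abs_nonneg (p : ℝ)
  have hq := abs_nonneg (q : ℝ)
  fin_cases j <;> simp [integerGains, Fin.sum_univ_three] <;> linarith

/-- The messages of three users, as nested pairs. -/
def messageEquiv (M : Fin 3 → Type*) : (∀ i, M i) ≃ M 0 × (M 1 × M 2) where
  toFun w := (w 0, (w 1, w 2))
  invFun m := Fin.cons m.1 (Fin.cons m.2.1 (Fin.cons m.2.2 finZeroElim))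
  left_inv w := by
    ext i
    fin_cases i <;> rfl
  right_inv _ := rfl

lemma messageEquiv_apply (M : Fin 3 → Type*) (w : ∀ i, M i) :
    messageEquiv M w = (w 0, (w 1, w 2)) := rfl

lemma entropy_comp_message_one_two {M : Fin 3 → Type*} [∀ i, Fintype (M i)] [∀ i, Nonempty (M i)]
    {α : Type*} (F : M 1 × M 2 → α) :
    entropy (fun w : ∀ i, M i => F (w 1, w 2)) = entropy F := by
  rw [← entropy_comp_snd (Ω := M 0) F]
  exact entropy_comp_equiv (messageEquiv M) (fun m => F m.2)

/-- Fano's inequality at the first receiver, which sees `X₁ + X₂ + X₃`. -/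
lemma log_card_message_zero_le (c : CodingScheme n R P) (p q : ℤ) {s : ℝ}
    (h : entropy (fun w => (c.roundedSignal (integerGains p q) 0 w, w 0)) ≤
      entropy (c.roundedSignal (integerGains p q) 0) + s) :
    Real.log (Fintype.card (Message n (R 0))) +
      entropy (c.roundedCodeword 1 ⊹ c.roundedCodeword 2) ≤
      entropy (c.roundedSignal (integerGains p q) 0) + s := by
  refine le_trans (le_of_eq ?_) h
  rw [← entropy_of_injective (X := fun m : Message n (R 0) => m) Function.injective_id,
    ← entropy_pair, ← entropy_comp_equiv (messageEquiv fun i => Message n (R i))]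
  refine entropy_congr fun w w' => ?_
  simp only [messageEquiv_apply, Prod.mk.injEq, indepSum]
  have e : ∀ w, c.roundedSignal (integerGains p q) 0 w = c.roundedCodeword 0 (w 0) +
      (c.roundedCodeword 1 (w 1) + c.roundedCodeword 2 (w 2)) := by
    intro w
    ext t
    simp [CodingScheme.roundedSignal, Fin.sum_univ_three, integerGains, add_assoc]
  rw [e, e]
  constructor
  · rintro ⟨h1, h2⟩
    exact ⟨by rw [h1, h2], h1⟩
  · rintro ⟨h1, h2⟩
    rw [h2, add_right_inj] at h1
    exact ⟨h2, h1⟩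

lemma roundedSignal_one (c : CodingScheme n R P) (p q : ℤ)
    (w : (i : Fin 3) → Message n (R i)) : c.roundedSignal (integerGains p q) 1 w =
      ((p • c.roundedCodeword 1) ⊹ (q • c.roundedCodeword 2)) (w 1, w 2) := by
  ext t
  simp [CodingScheme.roundedSignal, Fin.sum_univ_three, integerGains, indepSum, mul_comm]

lemma entropy_roundedSignal_one (c : CodingScheme n R P) (p q : ℤ) :
    entropy (c.roundedSignal (integerGains p q) 1) =
      entropy ((p • c.roundedCodeword 1) ⊹ (q • c.roundedCodeword 2)) := by
  rw [← entropy_comp_message_one_two (M := fun i => Message n (R i))]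
  exact congrArg entropy (funext (roundedSignal_one c p q))

/-- Fano's inequality at the second receiver, which sees `p X₂ + q X₃`. -/
lemma log_card_message_one_le (c : CodingScheme n R P) (p : ℤ) {q : ℤ} (hq : q ≠ 0) {s : ℝ}
    (h : entropy (fun w => (c.roundedSignal (integerGains p q) 1 w, w 1)) ≤
      entropy (c.roundedSignal (integerGains p q) 1) + s) :
    Real.log (Fintype.card (Message n (R 1))) + entropy (c.roundedCodeword 2) ≤
      entropy (c.roundedSignal (integerGains p q) 1) + s := by
  refine le_trans (le_of_eq ?_) h
  rw [← entropy_of_injective (X := fun m : Message n (R 1) => m) Function.injective_id,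
    ← entropy_pair, ← entropy_comp_message_one_two (M := fun i => Message n (R i))]
  refine entropy_congr fun w w' => ?_
  simp only [Prod.mk.injEq, roundedSignal_one, indepSum, Pi.smul_apply]
  constructor
  · rintro ⟨h1, h2⟩
    exact ⟨by rw [h1, h2], h1⟩
  · rintro ⟨h1, h2⟩
    rw [h2, add_right_inj] at h1
    exact ⟨h2, smul_right_injective _ hq h1⟩

/-- Fano's inequality at the third receiver, which sees `X₃`. -/
lemma log_card_message_two_le (c : CodingScheme n R P) (p q : ℤ) {s : ℝ}
    (h : entropy (fun w => (c.roundedSignal (integerGains p q) 2 w, w 2)) ≤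
      entropy (c.roundedSignal (integerGains p q) 2) + s) :
    Real.log (Fintype.card (Message n (R 2))) ≤ entropy (c.roundedCodeword 2) + s := by
  have h1 : entropy (c.roundedSignal (integerGains p q) 2) = entropy (c.roundedCodeword 2) := by
    rw [← entropy_comp_snd (Ω := Message n (R 1)) (c.roundedCodeword 2),
      ← entropy_comp_message_one_two (M := fun i => Message n (R i))]
    congr 1
    ext w t
    simp [CodingScheme.roundedSignal, Fin.sum_univ_three, integerGains]
  rw [h1] at h
  refine le_trans ?_ h
  rw [← entropy_of_injective (X := fun m : Message n (R 2) => m) Function.injective_id,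
    ← entropy_comp_snd (Ω := Message n (R 1)) (fun m : Message n (R 2) => m),
    ← entropy_comp_message_one_two (M := fun i => Message n (R i))]
  exact entropy_mono fun w w' h => (Prod.mk.inj h).2

lemma gap_pos (p q : ℤ) : 0 < gap p q := by
  have h : 0 ≤ max |p| |q| := le_max_of_le_left (abs_nonneg p)
  have h1 : (0 : ℝ) ≤ (dilationExponent p q : ℝ) := by
    unfold dilationExponent
    exact_mod_cast (by linarith)
  unfold gap
  positivity

/-- The linear programme behind the bound. Here `c₁, c₂, c₃` are the numbers of nats in the
messages, `N` bounds the entropy of every received signal, and `s` is the loss in Fano's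
inequality. -/
lemma sum_le_of_entropy_inequalities {p q : ℤ} {c₁ c₂ c₃ N s u₁ u₂ h x y : ℝ}
    (h1 : c₁ + h ≤ u₁ + s) (h2 : c₂ + y ≤ u₂ + s) (h3 : c₃ ≤ y + s) (hu₁ : u₁ ≤ N) (hu₂ : u₂ ≤ N)
    (hxy : u₂ ≤ x + y) (hx : x ≤ h) (hy : y ≤ h)
    (hdil : ∀ δ, h ≤ x + δ → h ≤ y + δ → u₂ ≤ h + (3 * |p| + 3 * |q| + 2) * δ) :
    c₁ + c₂ + c₃ ≤ (3 / 2 - gap p q) * N + 3 * s := by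
  set d : ℝ := (dilationExponent p q : ℝ) with hd
  have hk : (3 * |p| + 3 * |q| + 2 : ℝ) ≤ 3 * d ∧ 0 ≤ d := by
    have hp : |p| ≤ max |p| |q| := le_max_left _ _
    have hq : |q| ≤ max |p| |q| := le_max_right _ _
    have h0 := abs_nonneg p
    have e : 3 * |p| + 3 * |q| + 2 ≤ 3 * dilationExponent p q ∧ 0 ≤ dilationExponent p q := by
      unfold dilationExponent
      constructor <;> linarith
    rw [hd]
    exact_mod_cast e
  -- any two of the `cᵢ` have sum at most `N + 2 s`, so that `c₂` and `c₃` are at most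
  -- `2 N + 4 s - (c₁ + c₂ + c₃)`, while `h - x` and `h - y` are at most `N + 2 s - c₁ - c₂` and
  -- `N + 2 s - c₁ - c₃`
  set δ : ℝ := 3 * N + 6 * s - 2 * (c₁ + c₂ + c₃) with hδ
  have hδx : h ≤ x + δ := by rw [hδ]; linarith
  have hδy : h ≤ y + δ := by rw [hδ]; linarith
  have hδ0 : 0 ≤ δ := by linarith
  have h4 := hdil δ hδx hδy
  have h5 : (3 * |p| + 3 * |q| + 2 : ℝ) * δ ≤ 3 * d * δ := by
    gcongr
    exact_mod_cast hk.1
  have h6 : c₁ + c₂ + c₃ ≤ N + 3 * s + 3 * d * δ := by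
    push_cast at h4 h5
    linarith
  have h7 : (3 / 2 - gap p q) * N + 3 * s - (c₁ + c₂ + c₃) =
      (N + 3 * s + 3 * d * δ - (c₁ + c₂ + c₃)) / (1 + 6 * d) := by
    have hd0 := hk.2
    unfold gap
    rw [← hd, hδ]
    field_simp
    ring
  have h8 : 0 ≤ (N + 3 * s + 3 * d * δ - (c₁ + c₂ + c₃)) / (1 + 6 * d) :=
    div_nonneg (by linarith) (by linarith [hk.2])
  linarith

/-- The bound on the sum of the rates at a fixed block length. -/
lemma sum_log_card_message_le (c : CodingScheme n R P) (p : ℤ) {q : ℤ} (hq : q ≠ 0) {N s : ℝ}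
    (hN : ∀ j, entropy (c.roundedSignal (integerGains p q) j) ≤ N)
    (hs : ∀ j, entropy (fun w => (c.roundedSignal (integerGains p q) j w, w j)) ≤
      entropy (c.roundedSignal (integerGains p q) j) + s) :
    ∑ i, Real.log (Fintype.card (Message n (R i))) ≤ (3 / 2 - gap p q) * N + 3 * s := by
  rw [Fin.sum_univ_three]
  have hU := entropy_roundedSignal_one c p q
  -- dilating can only lower the entropy
  have hmono : entropy (p • c.roundedCodeword 1) + entropy (q • c.roundedCodeword 2) ≤
      entropy (c.roundedCodeword 1) + entropy (c.roundedCodeword 2) :=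
    add_le_add (entropy_mono fun w w' h => by simp only [Pi.smul_apply, h])
      (entropy_mono fun w w' h => by simp only [Pi.smul_apply, h])
  refine sum_le_of_entropy_inequalities (log_card_message_zero_le c p q (hs 0))
    (log_card_message_one_le c p hq (hs 1)) (log_card_message_two_le c p q (hs 2)) (hN 0) (hN 1)
    (x := entropy (c.roundedCodeword 1)) ?_ (entropy_le_indepSum_left _ _)
    (entropy_le_indepSum_right _ _) ?_
  · rw [hU]
    exact (entropy_indepSum_le_add _ _).trans hmono
  · intro δ h1 h2
    rw [hU]
    exact entropy_zsmul_indepSum_zsmul_le h1 h2 p q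

end ThreeUsers

section Asymptotics

lemma log_card_message (n : ℕ) (R : ℝ) :
    Real.log (Fintype.card (Message n R)) = ⌈(n : ℝ) * R⌉₊ * Real.log 2 := by
  rw [Fintype.card_fin, Nat.cast_pow, Real.log_pow, Nat.cast_ofNat]

/-- The bound on the sum rate at a fixed power. -/
lemma sum_rate_le {p q : ℤ} (hq : q ≠ 0) {Q : ℝ} (hQ : 1 ≤ Q) {R : Fin 3 → ℝ}
    (hR : R ∈ capacityRegion !![1, 0, 0; 1, (p : ℝ), 0; 1, (q : ℝ), 1] (fun _ => 1) fun _ => Q) :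
    (∑ i, R i) * Real.log 2 ≤ (3 / 2 - gap p q) *
        (1 / 2 * Real.log Q + (Real.log 5 + 2 * (3 + |(p : ℝ)| + |(q : ℝ)|))) +
      3 * Real.log (2 * Real.exp ((3 + |(p : ℝ)| + |(q : ℝ)|) ^ 2 / 2)) := by
  obtain ⟨hR0, c, hc⟩ := hR
  set B : ℝ := 3 + |(p : ℝ)| + |(q : ℝ)| with hB
  set C : ℝ := Real.log (2 * Real.exp (B ^ 2 / 2)) with hC
  set L : ℝ := 1 / 2 * Real.log Q + (Real.log 5 + 2 * B) with hL
  set S : ℝ := ∑ i, R i with hS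
  set H : Matrix (Fin 3) (Fin 3) ℝ := !![1, 0, 0; 1, (p : ℝ), 0; 1, (q : ℝ), 1] with hH
  have hlog2 : 0 < Real.log 2 := Real.log_pos (by norm_num)
  let η : ℕ → ℝ := fun n => (⨆ i, errorProb H (fun _ => 1) (c n) i).toReal
  have hη : Tendsto η atTop (𝓝 0) := by
    exact (ENNReal.tendsto_toReal ENNReal.zero_ne_top).comp hc
  have hinv : Tendsto (fun n : ℕ => 1 / (n : ℝ)) atTop (𝓝 0) := tendsto_one_div_atTop_nhds_zero_nat
  have hlim : Tendsto (fun n : ℕ => (3 / 2 - gap p q) * L + 3 * (Real.log 4 * (1 / (n : ℝ)) + C +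
      2 * η n * ((S + 1 / (n : ℝ)) * Real.log 2))) atTop
      (𝓝 ((3 / 2 - gap p q) * L + 3 * (Real.log 4 * 0 + C + 2 * 0 * ((S + 0) * Real.log 2)))) := by
    refine Tendsto.const_add _ (Tendsto.const_mul _ (Tendsto.add (Tendsto.add_const _ ?_) ?_))
    · exact hinv.const_mul _
    · exact (hη.const_mul 2).mul ((hinv.const_add S).mul_const _)
  have hlim' : (3 / 2 - gap p q) * L + 3 * (Real.log 4 * 0 + C + 2 * 0 * ((S + 0) * Real.log 2)) =
      (3 / 2 - gap p q) * L + 3 * C := by ring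
  rw [hlim'] at hlim
  refine ge_of_tendsto hlim ?_
  filter_upwards [eventually_ge_atTop 1, hc.eventually (gt_mem_nhds one_pos)] with n hn hsup
  have hn0 : (0 : ℝ) < n := by exact_mod_cast hn
  have hη0 : 0 ≤ η n := ENNReal.toReal_nonneg
  have hRS : ∀ j, R j ≤ S := fun j =>
    Finset.single_le_sum (fun i _ => hR0 i) (Finset.mem_univ j)
  have hFano : ∀ j, entropy (fun w => ((c n).roundedSignal (integerGains p q) j w, w j)) ≤
      entropy ((c n).roundedSignal (integerGains p q) j) +
        (Real.log 4 + n * C + 2 * η n * ((n * S + 1) * Real.log 2)) := by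
    intro j
    refine ((c n).entropy_roundedSignal_message_le (integerGains p q) j
      (sum_abs_integerGains_le p q j)).trans ?_
    rw [integerGains_map]
    have h1 : (errorProb H (fun _ => 1) (c n) j).toReal ≤ η n :=
      ENNReal.toReal_mono (ne_top_of_lt hsup) (le_iSup (errorProb H (fun _ => 1) (c n)) j)
    have h2 : Real.log (Fintype.card (Message n (R j))) ≤ (n * S + 1) * Real.log 2 := by
      rw [log_card_message]
      have h3 : (⌈(n : ℝ) * R j⌉₊ : ℝ) < n * R j + 1 :=
        Nat.ceil_lt_add_one (mul_nonneg hn0.le (hR0 j))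
      have h4 : (n : ℝ) * R j ≤ n * S := by gcongr; exact hRS j
      gcongr
      linarith
    have h5 : 0 ≤ Real.log (Fintype.card (Message n (R j))) := Real.log_natCast_nonneg _
    have h6 := mul_le_mul h1 h2 h5 hη0
    linarith
  have hmain := sum_log_card_message_le (c n) p hq
    (fun j => (c n).entropy_roundedSignal_le hQ (integerGains p q) j
      (sum_abs_integerGains_le p q j)) hFano
  have hlow : (n : ℝ) * (S * Real.log 2) ≤
      ∑ i, Real.log (Fintype.card (Message n (R i))) := by
    rw [hS, Finset.sum_mul, Finset.mul_sum]
    refine Finset.sum_le_sum fun i _ => ?_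
    rw [log_card_message, ← mul_assoc]
    gcongr
    exact Nat.le_ceil _
  have h9 := hlow.trans hmain
  have e : (3 / 2 - gap p q) * (n * L) +
      3 * (Real.log 4 + n * C + 2 * η n * ((n * S + 1) * Real.log 2)) =
      n * ((3 / 2 - gap p q) * L + 3 * (Real.log 4 * (1 / (n : ℝ)) + C +
        2 * η n * ((S + 1 / (n : ℝ)) * Real.log 2))) := by
    field_simp
  rw [e] at h9
  exact le_of_mul_le_mul_left h9 hn0

/-- A bound on the sum rate which is affine in `½ log P` bounds the degrees of freedom by its
slope. -/
lemma degreesOfFreedom_le_of_sum_rate_le {K : ℕ} {H : Matrix (Fin K) (Fin K) ℝ} {a b : ℝ}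
    (h : ∀ Q : ℝ, 1 ≤ Q → ∀ R ∈ capacityRegion H (fun _ => 1) fun _ => Q,
      (∑ i, R i) * Real.log 2 ≤ a * (1 / 2 * Real.log Q) + b) :
    degreesOfFreedom H ≤ (a : EReal) := by
  have hlog2 : 0 < Real.log 2 := Real.log_pos (by norm_num)
  have hlim : Tendsto (fun Q : ℝ => a + 2 * b / Real.log Q) atTop (𝓝 a) := by
    have := (Real.tendsto_log_atTop.const_div_atTop (2 * b)).const_add a
    simpa using this
  have hlim' := (continuous_coe_real_ereal.tendsto a).comp hlim
  rw [← hlim'.limsup_eq]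
  refine limsup_le_limsup ?_
  filter_upwards [eventually_gt_atTop 1] with Q hQ
  have hlogQ : 0 < Real.log Q := Real.log_pos hQ
  have hden : 0 < 1 / 2 * Real.logb 2 Q := by
    have := Real.logb_pos (b := 2) (by norm_num) hQ
    positivity
  have hsup : (⨆ R ∈ capacityRegion H (fun _ => 1) (fun _ => Q), ((∑ i, R i : ℝ) : EReal)) ≤
      (((a * (1 / 2 * Real.log Q) + b) / Real.log 2 : ℝ) : EReal) := by
    refine iSup₂_le fun R hR => ?_
    rw [EReal.coe_le_coe_iff, le_div_iff₀ hlog2]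
    exact h Q hQ.le R hR
  refine (EReal.div_le_div_right_of_nonneg (by exact_mod_cast hden.le) hsup).trans (le_of_eq ?_)
  rw [← EReal.coe_div]
  simp only [Function.comp_apply]
  congr 1
  unfold Real.logb
  field_simp

end Asymptotics

end GIFC

theorem mainTheorem4 (p q : ℤ) (hp : p ≠ 0) (hq : q ≠ 0) :
    0 < GIFC.gap p q ∧
      GIFC.degreesOfFreedom !![1, 0, 0; 1, (p : ℝ), 0; 1, (q : ℝ), 1] ≤
        ((3 / 2 - GIFC.gap p q : ℝ) : EReal) := by
  refine ⟨GIFC.gap_pos p q, GIFC.degreesOfFreedom_le_of_sum_rate_le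
    (b := (3 / 2 - GIFC.gap p q) * (Real.log 5 + 2 * (3 + |(p : ℝ)| + |(q : ℝ)|)) +
      3 * Real.log (2 * Real.exp ((3 + |(p : ℝ)| + |(q : ℝ)|) ^ 2 / 2))) fun Q hQ R hR => ?_⟩
  refine (GIFC.sum_rate_le hq hQ hR).trans (le_of_eq ?_)
  ring
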